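/- Let $\Omega\subset\mathbb R^3$ be the open unit ball, let $\gamma\in C^2(\overline\Omega)$ be real and positive with $\gamma=1$ near $\partial\Omega$, and let $q=\Delta\gamma^{1/2}/\gamma^{1/2}$ in $\Omega$, extended by $0$ to $\mathbb R^3$. For $z,w\in\mathbb C^3$ write $z\cdot w=\sum_j z_jw_j$ and let $|z|$ be the Hermitian norm. Put $\mathcal V=\{\zeta\in\mathbb C^3\setminus\{0\}:\zeta\cdot\zeta=0\}$ and, for $\xi\in\mathbb R^3$, $\mathcal V_\xi=\{\zeta\in\mathcal V:(\xi+\zeta)\cdot(\xi+\zeta)=0\}$. For $\zeta\in\mathcal V$ let $g_\zeta(x)=(2\pi)^{-3}\int_{\mathbb R^3}\frac{e^{ix\cdot\eta}}{|\eta|^2+2\eta\cdot\zeta}\,d\eta$ (in the sense of tempered distributions) be the Faddeev Green's function. A CGO solution at $\zeta$ is a continuous $\psi:\mathbb R^3\to\mathbb C$ with $(-\Delta+q)\psi=0$ in $\mathbb R^3$ (in the sense of distributions) such that $\mu(x)=e^{-ix\cdot\zeta}\psi(x)$ satisfies $\mu+g_\zeta*(q\mu)=1$ in $\mathbb R^3$.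 Call $\zeta\in\mathcal V$ admissible if there is exactly one CGO solution $\psi(\cdot,\zeta)$ at $\zeta$ (this is the case for all sufficiently large or small $\zeta\in\mathcal V$), and for $\xi\in\mathbb R^3$ and admissible $\zeta$ put $$\mathbf t(\xi,\zeta)=\int_\Omega e^{-ix\cdot(\xi+\zeta)}\psi(x,\zeta)\,q(x)\,dx.$$ For $\xi\in\mathbb R^3$ and $\zeta\in\mathcal V_\xi$ put $$\mathbf t^{\exp}(\xi,\zeta)=\int_{\partial\Omega}e^{-ix\cdot(\xi+\zeta)}\,\bigl((\Lambda_q-\Lambda_0)e^{ix\cdot\zeta}\bigr)\,d\sigma(x),$$ where $\Lambda_q f=\partial v/\partial\nu|_{\partial\Omega}$ and $v$ is the solution of $(-\Delta+q)v=0$ in $\Omega$, $v=f$ on $\partial\Omega$. (1) Let $R\in SO(3)$ and suppose $q(Rx)=q(x)$ for all $x\in\Omega$. Let $\xi\in\mathbb R^3$. If $\zeta\in\mathcal V$ is admissible, then so is $R\zeta$, and $\mathbf t(\xi,\zeta)=\mathbf t(R\xi,R\zeta)$. If $\zeta\in\mathcal V_\xi$, then $R\zeta\in\mathcal V_{R\xi}$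 and $\mathbf t^{\exp}(\xi,\zeta)=\mathbf t^{\exp}(R\xi,R\zeta)$. (2) Suppose $q$ is radially symmetric in $\Omega$. Let $\xi\in\mathbb R^3$ and $\zeta_1,\zeta_2\in\mathcal V_\xi$ with $|\zeta_1|=|\zeta_2|$. Then $\mathbf t^{\exp}(\xi,\zeta_1)=\mathbf t^{\exp}(\xi,\zeta_2)$; and if $\zeta_1$ is admissible, then so is $\zeta_2$, and $\mathbf t(\xi,\zeta_1)=\mathbf t(\xi,\zeta_2)$. -/

import Mathlib

open MeasureTheory Metric
open scoped ContDiff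

namespace Scattering

/-- Physical space `ℝ³` with its Euclidean norm. -/
abbrev R3 : Type := EuclideanSpace ℝ (Fin 3)

/-- Complex frequency space `ℂ³` with its Hermitian norm. -/
abbrev C3 : Type := EuclideanSpace ℂ (Fin 3)

/-- The inclusion `ℝ³ ⊆ ℂ³`. -/
noncomputable def toC3 (x : R3) : C3 := WithLp.toLp 2 (fun j => (x j : ℂ))

/-- The bilinear (not sesquilinear) product `z · w = ∑ j, z_j w_j` on `ℂ³`. -/
noncomputable def cdot (z w : C3) : ℂ := ∑ j, z j * w j

/-- The action of a real matrix on `ℝ³`. -/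
noncomputable def actR (A : Matrix (Fin 3) (Fin 3) ℝ) (x : R3) : R3 :=
  WithLp.toLp 2 (fun i => ∑ j, A i j * x j)

/-- The action of a real matrix on `ℂ³`. -/
noncomputable def actC (A : Matrix (Fin 3) (Fin 3) ℝ) (z : C3) : C3 :=
  WithLp.toLp 2 (fun i => ∑ j, (A i j : ℂ) * z j)

/-- The complex plane wave `x ↦ exp (i x · ζ)`. -/
noncomputable def planeWave (ζ : C3) (x : R3) : ℂ :=
  Complex.exp (Complex.I * cdot (toC3 x) ζ)

/-- The set `V = {ζ ∈ ℂ³ \ {0} : ζ · ζ = 0}`. -/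
def V : Set C3 := {ζ | ζ ≠ 0 ∧ cdot ζ ζ = 0}

/-- The set `V_ξ = {ζ ∈ V : (ξ + ζ) · (ξ + ζ) = 0}`. -/
def Vxi (ξ : R3) : Set C3 := {ζ | ζ ∈ V ∧ cdot (toC3 ξ + ζ) (toC3 ξ + ζ) = 0}

/-- The domain `Ω`, the open unit ball of `ℝ³`. -/
def Om : Set R3 := ball 0 1

/-- The closure of `Ω`. -/
def ClOm : Set R3 := closedBall 0 1

/-- A conductivity on the closed unit ball: positive, `C²` up to the boundary, and equal to `1`
near the boundary. Values outside the closed ball are irrelevant. -/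
structure IsConductivity (γ : R3 → ℝ) : Prop where
  contDiffOn : ContDiffOn ℝ 2 γ ClOm
  pos : ∀ x ∈ ClOm, 0 < γ x
  eq_one : ∃ r < (1 : ℝ), ∀ x ∈ ClOm, r < ‖x‖ → γ x = 1

open Classical in
/-- The Schrödinger potential `q = Δ(γ^(1/2)) / γ^(1/2)` in `Ω`, extended by zero to `ℝ³`. -/
noncomputable def potential (γ : R3 → ℝ) (x : R3) : ℝ :=
  if x ∈ Om then
    Laplacian.laplacian (fun y : R3 => Real.sqrt (γ y)) x / Real.sqrt (γ x)
  else 0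

/-- The Faddeev Green's function `g_ζ`, as a distribution: it is `(2π)⁻³` times the Fourier
transform, in the sense of tempered distributions, of `η ↦ 1 / (|η|² + 2 η · ζ)`, so that
`⟨g_ζ, φ⟩ = (2π)⁻³ ∫ (∫ exp (i x · η) φ(x) dx) / (|η|² + 2 η · ζ) dη`.
For `ζ ∈ V` the symbol `1 / (|η|² + 2 η · ζ)` is locally integrable, and the outer integral
converges absolutely for Schwartz `φ` and also for every compactly supported `φ ∈ L²`. -/
noncomputable def faddeevG (ζ : C3) (φ : R3 → ℂ) : ℂ :=
  ((2 * Real.pi : ℝ) : ℂ)⁻¹ ^ 3 *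
    ∫ η : R3, (∫ x : R3, Complex.exp (Complex.I * cdot (toC3 x) (toC3 η)) * φ x) /
      ((‖η‖ ^ 2 : ℝ) + 2 * cdot (toC3 η) ζ)

/-- The convolution `g_ζ ∗ f`, that is, `(g_ζ ∗ f)(x) = ⟨g_ζ, f(x - ·)⟩`. -/
noncomputable def faddeevConv (ζ : C3) (f : R3 → ℂ) (x : R3) : ℂ :=
  faddeevG ζ (fun y => f (x - y))

/-- `ψ` is a complex geometrical optics solution with frequency `ζ` for the potential `q`:
it solves `(-Δ + q) ψ = 0` in `ℝ³` (in the sense of distributions), and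
`μ(x) = exp (-i x · ζ) ψ(x)` solves the Faddeev-Lippmann-Schwinger equation
`μ + g_ζ ∗ (q μ) = 1` in `ℝ³`. -/
structure IsCGO (q : R3 → ℝ) (ζ : C3) (ψ : R3 → ℂ) : Prop where
  continuous : Continuous ψ
  schrodinger : ∀ φ : R3 → ℂ, ContDiff ℝ ∞ φ → HasCompactSupport φ →
    ∫ x, ψ x * (-(Laplacian.laplacian φ x) + (q x : ℂ) * φ x) = 0
  lippmannSchwinger : ∀ x, planeWave (-ζ) x * ψ x +
    faddeevConv ζ (fun y => (q y : ℂ) * (planeWave (-ζ) y * ψ y)) x = 1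

/-- The frequency `ζ ∈ V` admits exactly one complex geometrical optics solution, so that the
scattering transform is well defined at `ζ`. -/
def CGOWellDefined (q : R3 → ℝ) (ζ : C3) : Prop :=
  ζ ∈ V ∧ ∃! ψ : R3 → ℂ, IsCGO q ζ ψ

open Classical in
/-- The complex geometrical optics solution `ψ(·, ζ)` (zero where it is not well defined). -/
noncomputable def cgo (q : R3 → ℝ) (ζ : C3) : R3 → ℂ :=
  if h : CGOWellDefined q ζ then h.2.choose else 0

/-- The scattering transform `t(ξ, ζ) = ∫_Ω exp (-i x · (ξ + ζ)) ψ(x, ζ) q(x) dx`. -/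
noncomputable def scatteringT (q : R3 → ℝ) (ξ : R3) (ζ : C3) : ℂ :=
  ∫ x in Om, planeWave (-(toC3 ξ + ζ)) x * cgo q ζ x * (q x : ℂ)

/-- `v ∈ C²(Ω) ∩ C¹(closure Ω)` solves `(-Δ + q) v = 0` in `Ω` and `v = f` on the unit sphere. -/
structure IsDirichletSolution (q : R3 → ℝ) (f : sphere (0 : R3) 1 → ℂ) (v : R3 → ℂ) : Prop where
  contDiffOn_interior : ContDiffOn ℝ 2 v Om
  contDiffOn_closure : ContDiffOn ℝ 1 v ClOm
  equation : ∀ x ∈ Om, -(Laplacian.laplacian v x) + (q x : ℂ) * v x = 0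
  boundary : ∀ x : sphere (0 : R3) 1, v x = f x

/-- The Dirichlet problem for `-Δ + q` on `Ω` has exactly one solution with boundary values `f`. -/
def DirichletUniquelySolvable (q : R3 → ℝ) (f : sphere (0 : R3) 1 → ℂ) : Prop :=
  ∃ v : R3 → ℂ, IsDirichletSolution q f v ∧
    ∀ w : R3 → ℂ, IsDirichletSolution q f w → Set.EqOn w v ClOm

open Classical in
/-- The Dirichlet-to-Neumann map `Λ_q f = ∂v/∂ν` on the unit sphere, whose outward unit normal at
`x` is `x`, where `v` is the solution of the Dirichlet problem with boundary values `f`. When `q`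
is the potential of a conductivity and `f` is smooth, that problem is uniquely solvable, so the
value zero in the other case plays no role there. -/
noncomputable def dnMap (q : R3 → ℝ) (f : sphere (0 : R3) 1 → ℂ) (x : sphere (0 : R3) 1) : ℂ :=
  if h : DirichletUniquelySolvable q f then
    fderivWithin ℝ h.choose ClOm (x : R3) (x : R3)
  else 0

/-- The approximation
`t^exp(ξ, ζ) = ∫_{∂Ω} exp (-i x · (ξ + ζ)) (Λ_q - Λ_0) exp (i x · ζ) dσ(x)`, where `σ` is the
surface measure of the unit sphere. -/
noncomputable def scatteringTexp (q : R3 → ℝ) (ξ : R3) (ζ : C3) : ℂ :=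
  ∫ x : sphere (0 : R3) 1, planeWave (-(toC3 ξ + ζ)) x *
    (dnMap q (fun y => planeWave ζ y) x - dnMap (fun _ => 0) (fun y => planeWave ζ y) x)
    ∂((volume : Measure R3).toSphere)

end Scattering

/-!
Everything that enters the two scattering transforms is natural under linear isometries `L` of
`ℝ³`: Lebesgue measure, the surface measure of the unit sphere and the Laplacian are invariant, and
a plane wave `x ↦ exp (i x · ζ)` is carried to the one with frequency `ζ'` as soon as
`L x · ζ' = x · ζ` for all `x`, which is the relation `PhaseRelated L ζ ζ'`. Hence, when `q ∘ L = q`,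
composition with `L⁻¹` maps the solutions of the Faddeev-Lippmann-Schwinger equation at `ζ` to those
at `ζ'` (`IsCGO.comp_symm`), and the solutions of a Dirichlet problem to those of the rotated one
(`IsDirichletSolution.comp_symm`). Uniqueness of these solutions turns this into identities for
`cgo` and `dnMap`, and a change of variables gives the invariance of both transforms
(`scatteringT_eq_of_phaseRelated`, `scatteringTexp_eq_of_phaseRelated`).

For the first part, a matrix `R ∈ SO(3)` is such an isometry and `PhaseRelated` holds for `ζ` and
`R ζ`. For the second part, write `ζ = a + i b`. The conditions `ζ · ζ = 0` and
`(ξ + ζ) · (ξ + ζ) = 0` say that `|a| = |b|`, `a · b = 0`, `ξ · a = -|ξ|² / 2` and `ξ · b = 0`, so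
the Gram matrix of `(ξ, a, b)` is determined by `ξ` and `|ζ|`. Two families with the same Gram matrix
are related by an isometry (`exists_linearIsometryEquiv_of_gram_eq`), which here fixes `ξ` and
relates `ζ₁` to `ζ₂`. That isometry may reverse orientation; this does no harm, because a
radial potential is invariant under the whole orthogonal group.
-/

open scoped InnerProductSpace

/-! ### Isometries with prescribed values -/

/-- Two finite families with the same Gram matrix are related by an isometry of the whole space,
which is a product of reflections. -/
theorem exists_linearIsometryEquiv_of_gram_eq {F ι : Type*} [NormedAddCommGroup F]
    [InnerProductSpace ℝ F] (v w : ι → F) (h : ∀ i j, ⟪v i, v j⟫_ℝ = ⟪w i, w j⟫_ℝ)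
    (s : Finset ι) : ∃ L : F ≃ₗᵢ[ℝ] F, ∀ i ∈ s, L (v i) = w i := by
  classical
  induction s using Finset.induction_on with
  | empty => exact ⟨.refl ℝ F, by simp⟩
  | insert j s _ ih =>
    obtain ⟨L, hL⟩ := ih
    -- This reflection moves `L (v j)` to `w j` and fixes the vectors `w i` already reached.
    refine ⟨L.trans (Submodule.reflection (ℝ ∙ (L (v j) - w j))ᗮ), fun i hi => ?_⟩
    rcases Finset.mem_insert.1 hi with rfl | hi
    · refine Submodule.reflection_sub ?_
      rw [L.norm_map, ← sq_eq_sq₀ (norm_nonneg _) (norm_nonneg _),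
        ← real_inner_self_eq_norm_sq, ← real_inner_self_eq_norm_sq, h]
    · rw [LinearIsometryEquiv.trans_apply, hL i hi]
      refine Submodule.reflection_mem_subspace_eq_self ?_
      rw [Submodule.mem_orthogonal_singleton_iff_inner_left, inner_sub_right]
      nth_rewrite 1 [← hL i hi]
      rw [L.inner_map_map, h, sub_self]

/-! ### Invariance of the Laplacian and of the surface measure -/

theorem laplacian_comp_linearIsometryEquiv {E F : Type*} [NormedAddCommGroup E]
    [InnerProductSpace ℝ E] [FiniteDimensional ℝ E] [NormedAddCommGroup F] [NormedSpace ℝ F]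
    (L : E ≃ₗᵢ[ℝ] E) (f : E → F) (x : E) :
    Laplacian.laplacian (f ∘ L) x = Laplacian.laplacian f (L x) := by
  let b := stdOrthonormalBasis ℝ E
  have h : iteratedFDeriv ℝ 2 (f ∘ L) x =
      (iteratedFDeriv ℝ 2 f (L x)).compContinuousLinearMap
        fun _ => (L.toContinuousLinearEquiv : E →L[ℝ] E) := by
    simpa [iteratedFDerivWithin_univ] using
      L.toContinuousLinearEquiv.iteratedFDerivWithin_comp_right f (s := Set.univ)
        uniqueDiffOn_univ (x := x) (Set.mem_univ _) 2
  rw [InnerProductSpace.laplacian_eq_iteratedFDeriv_orthonormalBasis (f ∘ L) b,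
    InnerProductSpace.laplacian_eq_iteratedFDeriv_orthonormalBasis f (b.map L)]
  refine Finset.sum_congr rfl fun i _ => ?_
  rw [h, ContinuousMultilinearMap.compContinuousLinearMap_apply]
  congr 1
  ext k
  fin_cases k <;> simp

/-- The action of a linear isometry on the unit sphere. -/
def LinearIsometryEquiv.unitSphere {E : Type*} [NormedAddCommGroup E] [NormedSpace ℝ E]
    (L : E ≃ₗᵢ[ℝ] E) : sphere (0 : E) 1 ≃ₜ sphere (0 : E) 1 :=
  L.toHomeomorph.subtype fun x => by simp

@[simp]
theorem LinearIsometryEquiv.coe_unitSphere {E : Type*} [NormedAddCommGroup E] [NormedSpace ℝ E]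
    (L : E ≃ₗᵢ[ℝ] E) (x : sphere (0 : E) 1) : (L.unitSphere x : E) = L x := rfl

open scoped Pointwise in
theorem LinearIsometryEquiv.measurePreserving_unitSphere {E : Type*} [NormedAddCommGroup E]
    [NormedSpace ℝ E] [MeasurableSpace E] [BorelSpace E] (L : E ≃ₗᵢ[ℝ] E)
    {μ : Measure E} (hL : MeasurePreserving L μ μ) :
    MeasurePreserving L.unitSphere μ.toSphere μ.toSphere := by
  refine ⟨L.unitSphere.continuous.measurable, Measure.ext fun s hs => ?_⟩
  rw [Measure.map_apply L.unitSphere.continuous.measurable hs,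
    Measure.toSphere_apply' _ (L.unitSphere.continuous.measurable hs),
    Measure.toSphere_apply' _ hs,
    ← hL.measure_preimage_emb L.toHomeomorph.measurableEmbedding
      (Set.Ioo (0 : ℝ) 1 • (Subtype.val '' s))]
  congr 2
  ext x
  simp only [Set.mem_smul, Set.mem_image, Set.mem_preimage]
  constructor
  · rintro ⟨r, hr, _, ⟨y, hy, rfl⟩, rfl⟩
    exact ⟨r, hr, _, ⟨_, hy, rfl⟩, by simp⟩
  · rintro ⟨r, hr, _, ⟨y, hy, rfl⟩, hx : r • (y : E) = L x⟩
    refine ⟨r, hr, _, ⟨L.unitSphere.symm y, by simpa using hy, rfl⟩, L.injective ?_⟩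
    rw [← hx]
    exact (L.toLinearEquiv.map_smul r _).trans
      (congrArg (r • ·) (congrArg Subtype.val (L.unitSphere.apply_symm_apply y)))

namespace Scattering

/-! ### Real and imaginary parts of frequencies -/

/-- The real part of a complex frequency. -/
noncomputable def reR (ζ : C3) : R3 := WithLp.toLp 2 fun j => (ζ j).re

/-- The imaginary part of a complex frequency. -/
noncomputable def imR (ζ : C3) : R3 := WithLp.toLp 2 fun j => (ζ j).im

theorem cdot_toC3 (x : R3) (ζ : C3) :
    cdot (toC3 x) ζ = (⟪x, reR ζ⟫_ℝ : ℂ) + (⟪x, imR ζ⟫_ℝ : ℂ) * Complex.I := by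
  apply Complex.ext <;>
    simp [cdot, toC3, reR, imR, PiLp.inner_apply, Fin.sum_univ_three, mul_comm]

theorem cdot_toC3_self (x : R3) : cdot (toC3 x) (toC3 x) = ((‖x‖ ^ 2 : ℝ) : ℂ) := by
  rw [EuclideanSpace.norm_sq_eq]
  simp [cdot, toC3, sq, ← Complex.ofReal_mul]

theorem cdot_self (ζ : C3) :
    cdot ζ ζ = ((‖reR ζ‖ ^ 2 - ‖imR ζ‖ ^ 2 : ℝ) : ℂ) +
      ((2 * ⟪reR ζ, imR ζ⟫_ℝ : ℝ) : ℂ) * Complex.I := by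
  apply Complex.ext <;>
    simp [cdot, reR, imR, PiLp.inner_apply, Fin.sum_univ_three, EuclideanSpace.norm_sq_eq,
      -Complex.ofReal_pow] <;> ring

theorem norm_sq_eq_re_im (ζ : C3) : ‖ζ‖ ^ 2 = ‖reR ζ‖ ^ 2 + ‖imR ζ‖ ^ 2 := by
  simp only [EuclideanSpace.norm_sq_eq, reR, imR, ← Finset.sum_add_distrib]
  refine Finset.sum_congr rfl fun i _ => ?_
  rw [← Complex.normSq_eq_norm_sq, Complex.normSq_apply]
  simp [sq]

theorem norm_re_sq_of_mem_V {ζ : C3} (h : ζ ∈ V) : ‖reR ζ‖ ^ 2 = ‖ζ‖ ^ 2 / 2 := by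
  have := congrArg Complex.re ((cdot_self ζ).symm.trans h.2)
  simp [-Complex.ofReal_pow, -Complex.ofReal_sub] at this
  linarith [norm_sq_eq_re_im ζ]

theorem norm_im_sq_of_mem_V {ζ : C3} (h : ζ ∈ V) : ‖imR ζ‖ ^ 2 = ‖ζ‖ ^ 2 / 2 := by
  linarith [norm_sq_eq_re_im ζ, norm_re_sq_of_mem_V h]

theorem inner_re_im_of_mem_V {ζ : C3} (h : ζ ∈ V) : ⟪reR ζ, imR ζ⟫_ℝ = 0 := by
  have := congrArg Complex.im ((cdot_self ζ).symm.trans h.2)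
  simpa [-Complex.ofReal_pow, -Complex.ofReal_sub] using this

theorem cdot_toC3_of_mem_Vxi {ξ : R3} {ζ : C3} (h : ζ ∈ Vxi ξ) :
    cdot (toC3 ξ) ζ = ((-‖ξ‖ ^ 2 / 2 : ℝ) : ℂ) := by
  have h₁ : cdot (toC3 ξ + ζ) (toC3 ξ + ζ) =
      cdot (toC3 ξ) (toC3 ξ) + 2 * cdot (toC3 ξ) ζ + cdot ζ ζ := by
    simp only [cdot, Fin.sum_univ_three, PiLp.add_apply]
    ring
  rw [h.2, h.1.2, cdot_toC3_self] at h₁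
  push_cast at h₁ ⊢
  linear_combination -h₁ / 2

theorem inner_re_of_mem_Vxi {ξ : R3} {ζ : C3} (h : ζ ∈ Vxi ξ) :
    ⟪ξ, reR ζ⟫_ℝ = -‖ξ‖ ^ 2 / 2 := by
  have := congrArg Complex.re ((cdot_toC3 ξ ζ).symm.trans (cdot_toC3_of_mem_Vxi h))
  rw [Complex.ofReal_re] at this
  simpa using this

theorem inner_im_of_mem_Vxi {ξ : R3} {ζ : C3} (h : ζ ∈ Vxi ξ) : ⟪ξ, imR ζ⟫_ℝ = 0 := by
  have := congrArg Complex.im ((cdot_toC3 ξ ζ).symm.trans (cdot_toC3_of_mem_Vxi h))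
  rw [Complex.ofReal_im] at this
  simpa using this

/-! ### Frequencies related by an isometry -/

/-- The frequency `ζ'` is the image of `ζ` under the complexification of the isometry `L`,
expressed by the equality of the phases `L x · ζ'` and `x · ζ`. -/
def PhaseRelated (L : R3 ≃ₗᵢ[ℝ] R3) (ζ ζ' : C3) : Prop :=
  ∀ x, cdot (toC3 (L x)) ζ' = cdot (toC3 x) ζ

namespace PhaseRelated

variable {L : R3 ≃ₗᵢ[ℝ] R3} {ζ ζ' η η' : C3}

theorem of_re_im (hre : L (reR ζ) = reR ζ') (him : L (imR ζ) = imR ζ') : PhaseRelated L ζ ζ' := by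
  intro x
  rw [cdot_toC3, cdot_toC3, ← hre, ← him, L.inner_map_map, L.inner_map_map]

theorem toC3 (L : R3 ≃ₗᵢ[ℝ] R3) (ξ : R3) : PhaseRelated L (toC3 ξ) (toC3 (L ξ)) :=
  of_re_im rfl <| by
    have h (x : R3) : imR (Scattering.toC3 x) = 0 := by ext i; simp [imR, Scattering.toC3]
    rw [h, h, map_zero]

theorem symm (h : PhaseRelated L ζ ζ') : PhaseRelated L.symm ζ' ζ := fun x => by
  simpa using (h (L.symm x)).symm

theorem neg (h : PhaseRelated L ζ ζ') : PhaseRelated L (-ζ) (-ζ') := fun x => by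
  simpa [cdot] using h x

theorem add (h : PhaseRelated L ζ ζ') (k : PhaseRelated L η η') :
    PhaseRelated L (ζ + η) (ζ' + η') := fun x => by
  simpa [cdot, mul_add, Finset.sum_add_distrib] using congrArg₂ (· + ·) (h x) (k x)

theorem planeWave_eq (h : PhaseRelated L ζ ζ') (x : R3) :
    planeWave ζ' (L x) = planeWave ζ x := by
  simp only [planeWave, h x]

end PhaseRelated

/-- The isometry of the second part: it fixes `ξ` and carries `ζ₁` to `ζ₂`. -/
theorem exists_phaseRelated_of_mem_Vxi {ξ : R3} {ζ₁ ζ₂ : C3} (h₁ : ζ₁ ∈ Vxi ξ)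
    (h₂ : ζ₂ ∈ Vxi ξ) (h : ‖ζ₁‖ = ‖ζ₂‖) :
    ∃ L : R3 ≃ₗᵢ[ℝ] R3, L ξ = ξ ∧ PhaseRelated L ζ₁ ζ₂ := by
  obtain ⟨L, hL⟩ := exists_linearIsometryEquiv_of_gram_eq
    ![ξ, reR ζ₁, imR ζ₁] ![ξ, reR ζ₂, imR ζ₂] (fun i j => by
      fin_cases i <;> fin_cases j <;>
        simp [real_inner_comm ξ, real_inner_comm (reR ζ₁) (imR ζ₁),
          real_inner_comm (reR ζ₂) (imR ζ₂), inner_re_of_mem_Vxi h₁, inner_re_of_mem_Vxi h₂,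
          inner_im_of_mem_Vxi h₁, inner_im_of_mem_Vxi h₂, inner_re_im_of_mem_V h₁.1,
          inner_re_im_of_mem_V h₂.1, norm_re_sq_of_mem_V h₁.1,
          norm_re_sq_of_mem_V h₂.1, norm_im_sq_of_mem_V h₁.1, norm_im_sq_of_mem_V h₂.1, h])
    Finset.univ
  exact ⟨L, hL 0 (Finset.mem_univ _),
    .of_re_im (hL 1 (Finset.mem_univ _)) (hL 2 (Finset.mem_univ _))⟩

/-! ### Orthogonal matrices -/

section Matrix

variable {A : Matrix (Fin 3) (Fin 3) ℝ}

theorem sum_column_mul_column (hA : A.transpose * A = 1) (j k : Fin 3) :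
    ∑ i, A i j * A i k = if j = k then 1 else 0 := by
  simpa [Matrix.mul_apply, Matrix.one_apply] using congrFun (congrFun hA j) k

theorem cdot_actC_actC (hA : A.transpose * A = 1) (z w : C3) :
    cdot (actC A z) (actC A w) = cdot z w := by
  have key (j k : Fin 3) : ∑ i, (A i j : ℂ) * A i k = if j = k then 1 else 0 := by
    have := congrArg (fun r : ℝ => (r : ℂ)) (sum_column_mul_column hA j k)
    rw [apply_ite Complex.ofReal] at this
    simpa using this
  calc cdot (actC A z) (actC A w)
      = ∑ i, ∑ j, ∑ k, z j * w k * ((A i j : ℂ) * A i k) := by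
        simp only [cdot, actC, Finset.sum_mul_sum]
        exact Finset.sum_congr rfl fun i _ => Finset.sum_congr rfl fun j _ =>
          Finset.sum_congr rfl fun k _ => by ring
    _ = ∑ j, ∑ k, z j * w k * ∑ i, (A i j : ℂ) * A i k := by
        rw [Finset.sum_comm]
        refine Finset.sum_congr rfl fun j _ => ?_
        rw [Finset.sum_comm]
        exact Finset.sum_congr rfl fun k _ => (Finset.mul_sum ..).symm
    _ = cdot z w := by simp [key, cdot]

theorem toC3_actR (A : Matrix (Fin 3) (Fin 3) ℝ) (x : R3) : toC3 (actR A x) = actC A (toC3 x) := by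
  ext i
  simp [toC3, actR, actC]

theorem actC_add (A : Matrix (Fin 3) (Fin 3) ℝ) (z w : C3) :
    actC A (z + w) = actC A z + actC A w := by
  ext i
  simp [actC, mul_add, Finset.sum_add_distrib]

theorem exists_linearIsometryEquiv_actR (hA : A.transpose * A = 1) :
    ∃ L : R3 ≃ₗᵢ[ℝ] R3, ∀ x, L x = actR A x := by
  let T : R3 →ₗ[ℝ] R3 :=
    { toFun := actR A
      map_add' := fun x y => by ext i; simp [actR, mul_add, Finset.sum_add_distrib]
      map_smul' := fun r x => by ext i; simp [actR, Finset.mul_sum, mul_left_comm] }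
  have hT (x : R3) : ‖T x‖ = ‖x‖ := by
    rw [← sq_eq_sq₀ (norm_nonneg _) (norm_nonneg _), ← Complex.ofReal_inj, ← cdot_toC3_self,
      ← cdot_toC3_self]
    exact (congrArg₂ cdot (toC3_actR A x) (toC3_actR A x)).trans (cdot_actC_actC hA _ _)
  exact ⟨LinearIsometry.toLinearIsometryEquiv ⟨T, hT⟩ rfl, fun x => rfl⟩

theorem phaseRelated_actC (hA : A.transpose * A = 1) {L : R3 ≃ₗᵢ[ℝ] R3}
    (hL : ∀ x, L x = actR A x) (ζ : C3) : PhaseRelated L ζ (actC A ζ) := fun x => by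
  rw [hL, toC3_actR, cdot_actC_actC hA]

theorem actC_mem_V (hA : A.transpose * A = 1) {ζ : C3} (h : ζ ∈ V) : actC A ζ ∈ V := by
  refine ⟨fun h₀ => h.1 ?_, by rw [cdot_actC_actC hA]; exact h.2⟩
  ext j
  -- The bilinear product is non-degenerate, so `A ζ = 0` forces `ζ = 0`.
  have := cdot_actC_actC hA (EuclideanSpace.single j 1) ζ
  rw [h₀] at this
  simpa [cdot] using this.symm

theorem actC_mem_Vxi (hA : A.transpose * A = 1) {ξ : R3} {ζ : C3} (h : ζ ∈ Vxi ξ) :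
    actC A ζ ∈ Vxi (actR A ξ) := by
  refine ⟨actC_mem_V hA h.1, ?_⟩
  rw [toC3_actR, ← actC_add, cdot_actC_actC hA]
  exact h.2

end Matrix

/-! ### Complex geometrical optics solutions -/

section CGO

variable {L : R3 ≃ₗᵢ[ℝ] R3} {ζ ζ' : C3} {q : R3 → ℝ}

theorem integral_comp_isometry (L : R3 ≃ₗᵢ[ℝ] R3) (f : R3 → ℂ) : ∫ x, f (L x) = ∫ x, f x :=
  L.measurePreserving.integral_comp L.toHomeomorph.measurableEmbedding f

theorem faddeevG_comp (h : PhaseRelated L ζ ζ') (φ : R3 → ℂ) :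
    faddeevG ζ (φ ∘ L) = faddeevG ζ' φ := by
  simp only [faddeevG]
  congr 1
  refine Eq.trans ?_ (integral_comp_isometry L _)
  congr 1 with η
  rw [← integral_comp_isometry L fun x => _ * φ x, h η, L.norm_map]
  simp only [PhaseRelated.toC3 L η _, Function.comp_apply]

theorem faddeevConv_comp (h : PhaseRelated L ζ ζ') (f : R3 → ℂ) (x : R3) :
    faddeevConv ζ (f ∘ L) x = faddeevConv ζ' f (L x) := by
  simp only [faddeevConv, ← faddeevG_comp h]
  congr 1 with y
  simp

theorem IsCGO.comp_symm {ψ : R3 → ℂ} (h : PhaseRelated L ζ ζ') (hq : ∀ x, q (L x) = q x)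
    (hψ : IsCGO q ζ ψ) : IsCGO q ζ' (ψ ∘ L.symm) where
  continuous := hψ.continuous.comp L.symm.continuous
  schrodinger φ hφ hc := by
    rw [← hψ.schrodinger (φ ∘ L) (hφ.comp L.contDiff)
      (hc.comp_homeomorph L.toHomeomorph), ← integral_comp_isometry L]
    congr 1 with x
    simp [laplacian_comp_linearIsometryEquiv, hq]
  lippmannSchwinger x := by
    obtain ⟨x, rfl⟩ := L.surjective x
    rw [← hψ.lippmannSchwinger x, ← faddeevConv_comp h, h.neg.planeWave_eq]
    congr 2
    · simp
    · ext y
      simp [hq, h.neg.planeWave_eq]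

theorem CGOWellDefined.of_phaseRelated (h : PhaseRelated L ζ ζ') (hq : ∀ x, q (L x) = q x)
    (hζ' : ζ' ∈ V) (hζ : CGOWellDefined q ζ) : CGOWellDefined q ζ' := by
  obtain ⟨-, ψ, hψ, huniq⟩ := hζ
  refine ⟨hζ', ψ ∘ L.symm, hψ.comp_symm h hq, fun χ hχ => ?_⟩
  rw [← huniq _ (hχ.comp_symm h.symm fun x => by rw [← hq, L.apply_symm_apply])]
  ext x
  simp

theorem cgo_comp (h : PhaseRelated L ζ ζ') (hq : ∀ x, q (L x) = q x) (hζ : CGOWellDefined q ζ)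
    (hζ' : CGOWellDefined q ζ') (x : R3) : cgo q ζ' (L x) = cgo q ζ x := by
  have h₁ : IsCGO q ζ (cgo q ζ) := by
    rw [cgo, dif_pos hζ]
    exact hζ.2.choose_spec.1
  have h₂ : IsCGO q ζ' (cgo q ζ') := by
    rw [cgo, dif_pos hζ']
    exact hζ'.2.choose_spec.1
  rw [hζ'.2.unique h₂ (h₁.comp_symm h hq)]
  simp

theorem scatteringT_eq_of_phaseRelated (h : PhaseRelated L ζ ζ') (hq : ∀ x, q (L x) = q x)
    (hζ : CGOWellDefined q ζ) (hζ' : CGOWellDefined q ζ') (ξ : R3) :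
    scatteringT q ξ ζ = scatteringT q (L ξ) ζ' := by
  have hOm : L ⁻¹' Om = Om := by
    ext x
    simp [Om]
  have key := L.measurePreserving.setIntegral_preimage_emb L.toHomeomorph.measurableEmbedding
    (fun x => planeWave (-(toC3 (L ξ) + ζ')) x * cgo q ζ' x * (q x : ℂ)) Om
  rw [scatteringT, scatteringT, ← key, hOm]
  simp only [((PhaseRelated.toC3 L ξ).add h).neg.planeWave_eq, cgo_comp h hq hζ hζ', hq]

end CGO

/-! ### The Dirichlet-to-Neumann map -/

section Dirichlet

variable {L : R3 ≃ₗᵢ[ℝ] R3} {ζ ζ' : C3} {q : R3 → ℝ} {f f' : sphere (0 : R3) 1 → ℂ}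

theorem mapsTo_ClOm (L : R3 ≃ₗᵢ[ℝ] R3) : Set.MapsTo L ClOm ClOm := fun x hx => by
  simpa [ClOm] using hx

theorem mapsTo_Om (L : R3 ≃ₗᵢ[ℝ] R3) : Set.MapsTo L Om Om := fun x hx => by
  simpa [Om] using hx

theorem IsDirichletSolution.comp_symm {v : R3 → ℂ} (hq : ∀ x, q (L x) = q x)
    (hf : ∀ x, f' (L.unitSphere x) = f x) (hv : IsDirichletSolution q f v) :
    IsDirichletSolution q f' (v ∘ L.symm) where
  contDiffOn_interior :=
    hv.contDiffOn_interior.comp L.symm.contDiff.contDiffOn (mapsTo_Om L.symm)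
  contDiffOn_closure :=
    hv.contDiffOn_closure.comp L.symm.contDiff.contDiffOn (mapsTo_ClOm L.symm)
  equation x hx := by
    have := hv.equation _ (mapsTo_Om L.symm hx)
    rw [laplacian_comp_linearIsometryEquiv, Function.comp_apply]
    rwa [← hq, L.apply_symm_apply] at this
  boundary x := by
    obtain ⟨x, rfl⟩ := L.unitSphere.surjective x
    simp [hf, hv.boundary]

theorem dirichletUniquelySolvable_comp (hq : ∀ x, q (L x) = q x)
    (hf : ∀ x, f' (L.unitSphere x) = f x) (h : DirichletUniquelySolvable q f) :
    DirichletUniquelySolvable q f' := by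
  obtain ⟨v, hv, huniq⟩ := h
  refine ⟨v ∘ L.symm, hv.comp_symm hq hf, fun w hw => fun x hx => ?_⟩
  have hw' : IsDirichletSolution q f (w ∘ L.symm.symm) :=
    hw.comp_symm (fun x => by rw [← hq, L.apply_symm_apply]) fun x => by
      rw [← hf]
      exact congrArg f' (L.unitSphere.apply_symm_apply x)
  simpa using huniq _ hw' (mapsTo_ClOm L.symm hx)

/-- The normal derivative in `dnMap` may be computed from any solution, since the solution is
unique on the closed ball and only its values there matter. -/
theorem dnMap_eq {v : R3 → ℂ} (h : DirichletUniquelySolvable q f) (hv : IsDirichletSolution q f v)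
    (x : sphere (0 : R3) 1) : dnMap q f x = fderivWithin ℝ v ClOm (x : R3) (x : R3) := by
  have heq := h.choose_spec.2 v hv
  have hx : (x : R3) ∈ ClOm := sphere_subset_closedBall x.2
  rw [dnMap, dif_pos h, fderivWithin_congr heq (heq hx)]

theorem dnMap_comp (hq : ∀ x, q (L x) = q x) (hf : ∀ x, f' (L.unitSphere x) = f x)
    (x : sphere (0 : R3) 1) : dnMap q f' (L.unitSphere x) = dnMap q f x := by
  by_cases h : DirichletUniquelySolvable q f
  · obtain ⟨v, hv, -⟩ := id h
    have hpre : L.symm ⁻¹' ClOm = ClOm := by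
      ext y
      simp [ClOm]
    have hud : UniqueDiffWithinAt ℝ (L.symm ⁻¹' ClOm) (L x) := by
      rw [hpre]
      exact uniqueDiffOn_convex (convex_closedBall (0 : R3) 1)
        ⟨0, ball_subset_interior_closedBall (mem_ball_self one_pos)⟩ _
        (mapsTo_ClOm L (sphere_subset_closedBall x.2))
    have hd := L.symm.toContinuousLinearEquiv.comp_right_fderivWithin (f := v) (s := ClOm) hud
    simp only [LinearIsometryEquiv.coe_toContinuousLinearEquiv, hpre] at hd
    rw [dnMap_eq h hv, dnMap_eq (dirichletUniquelySolvable_comp hq hf h) (hv.comp_symm hq hf),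
      L.coe_unitSphere, hd]
    simp
  · -- Solvability is itself invariant, so that both sides have the default value zero.
    have h' : ¬ DirichletUniquelySolvable q f' := fun h' =>
      h (dirichletUniquelySolvable_comp (L := L.symm)
        (fun x => by rw [← hq, L.apply_symm_apply]) (fun x => by
          rw [← hf]
          exact congrArg f' (L.unitSphere.apply_symm_apply x)) h')
    rw [dnMap, dnMap, dif_neg h, dif_neg h']

theorem scatteringTexp_eq_of_phaseRelated (h : PhaseRelated L ζ ζ') (hq : ∀ x, q (L x) = q x)
    (ξ : R3) : scatteringTexp q ξ ζ = scatteringTexp q (L ξ) ζ' := by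
  have key := (L.measurePreserving_unitSphere L.measurePreserving).integral_comp
    L.unitSphere.measurableEmbedding (fun x => planeWave (-(toC3 (L ξ) + ζ')) x *
      (dnMap q (fun y => planeWave ζ' y) x - dnMap (fun _ => 0) (fun y => planeWave ζ' y) x))
  rw [scatteringTexp, scatteringTexp, ← key]
  congr 1 with x
  have hf : ∀ y : sphere (0 : R3) 1, planeWave ζ' (L.unitSphere y) = planeWave ζ y :=
    fun y => h.planeWave_eq y
  rw [dnMap_comp (f' := fun y => planeWave ζ' y) hq hf,
    dnMap_comp (f' := fun y => planeWave ζ' y) (fun _ => rfl) hf, L.coe_unitSphere,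
    ((PhaseRelated.toC3 L ξ).add h).neg.planeWave_eq]

end Dirichlet

/-! ### Symmetric potentials -/

/-- Outside `Ω` the potential vanishes, so that its invariance there is automatic. -/
theorem potential_comp_of_forall_mem_Om {γ : R3 → ℝ} {L : R3 ≃ₗᵢ[ℝ] R3}
    (h : ∀ x ∈ Om, potential γ (L x) = potential γ x) (x : R3) :
    potential γ (L x) = potential γ x := by
  by_cases hx : x ∈ Om
  · exact h x hx
  · have hLx : L x ∉ Om := by simpa [Om] using hx
    rw [potential, potential, if_neg hx, if_neg hLx]

end Scattering

open Scattering in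
theorem mainTheorem2 (γ : R3 → ℝ) (hγ : IsConductivity γ) :
    (∀ R ∈ Matrix.specialOrthogonalGroup (Fin 3) ℝ,
      (∀ x ∈ Om, potential γ (actR R x) = potential γ x) →
      ∀ (ξ : R3) (ζ : C3),
        (CGOWellDefined (potential γ) ζ →
          CGOWellDefined (potential γ) (actC R ζ) ∧
          scatteringT (potential γ) ξ ζ =
            scatteringT (potential γ) (actR R ξ) (actC R ζ)) ∧
        (ζ ∈ Vxi ξ →
          actC R ζ ∈ Vxi (actR R ξ) ∧
          scatteringTexp (potential γ) ξ ζ =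
            scatteringTexp (potential γ) (actR R ξ) (actC R ζ))) ∧
    ((∀ x ∈ Om, ∀ y ∈ Om, ‖x‖ = ‖y‖ → potential γ x = potential γ y) →
      ∀ (ξ : R3), ∀ ζ₁ ∈ Vxi ξ, ∀ ζ₂ ∈ Vxi ξ, ‖ζ₁‖ = ‖ζ₂‖ →
        (CGOWellDefined (potential γ) ζ₁ →
          CGOWellDefined (potential γ) ζ₂ ∧
          scatteringT (potential γ) ξ ζ₁ = scatteringT (potential γ) ξ ζ₂) ∧
        scatteringTexp (potential γ) ξ ζ₁ = scatteringTexp (potential γ) ξ ζ₂) := by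
  refine ⟨fun R hR hq ξ ζ => ?_, fun hq ξ ζ₁ h₁ ζ₂ h₂ hn => ?_⟩
  · have hA : R.transpose * R = 1 := (Matrix.mem_orthogonalGroup_iff' (Fin 3) ℝ).1
      (Matrix.mem_specialOrthogonalGroup_iff.1 hR).1
    obtain ⟨L, hL⟩ := exists_linearIsometryEquiv_actR hA
    have hrel := phaseRelated_actC hA hL ζ
    have hqL := potential_comp_of_forall_mem_Om (γ := γ) (L := L) fun x hx => by
      rw [hL, hq x hx]
    rw [← hL ξ]
    refine ⟨fun h => ?_, fun h => ⟨hL ξ ▸ actC_mem_Vxi hA h,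
      scatteringTexp_eq_of_phaseRelated hrel hqL ξ⟩⟩
    have h' := h.of_phaseRelated hrel hqL (actC_mem_V hA h.1)
    exact ⟨h', scatteringT_eq_of_phaseRelated hrel hqL h h' ξ⟩
  · obtain ⟨L, hξ, hrel⟩ := exists_phaseRelated_of_mem_Vxi h₁ h₂ hn
    have hqL := potential_comp_of_forall_mem_Om (γ := γ) (L := L) fun x hx =>
      hq _ (mapsTo_Om L hx) _ hx (L.norm_map x)
    refine ⟨fun h => ?_, ?_⟩
    · have h' := h.of_phaseRelated hrel hqL h₂.1
      refine ⟨h', ?_⟩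
      rw [scatteringT_eq_of_phaseRelated hrel hqL h h' ξ, hξ]
    · rw [scatteringTexp_eq_of_phaseRelated hrel hqL ξ, hξ]
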